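/- Consider a two-armed contextual bandit. The triples $(X_i,Y_i(0),Y_i(1))$, $i\ge 1$, are i.i.d. with $X\sim\mathrm{Unif}(0,1)$ and $Y(a)=F_a(X)+\varepsilon$ for $a\in\{0,1\}$, where $\varepsilon$ is independent of $X$. For $\tilde C,L>0$ let $\mathcal D(\tilde C,L)$ be the class of all such models in which $F_0,F_1:[0,1]\to[0,1]$ are non-decreasing and $\varepsilon$ has finite first moment, mean zero, a distribution symmetric around $0$, and a distribution function $F$ with $|F(t)-F(0)|>\tilde C|t|$ for all $0<|t|\le L$. For an integer $k\ge1$ let $\mathcal D^{(k)}(\tilde C,L)$ be the subclass in which $F_0$ and $F_1$ each have exactly $k$ constant pieces, i.e. each takes exactly $k$ distinct values. (A lower bound over this class holds a fortiori over the class with at most $k$ pieces.) A policy $\pi$ chooses in each round $t$ an arm $A_t\in\{0,1\}$ as a measurable function of the past contexts and observed rewards $(X_i,Y_i(A_i))_{i<t}$, of the current context $X_t$, and possibly of a random seed that is uniform on $[0,1]$ and independent of everything else. Let $F_*=\max\{F_0,F_1\}$ and $$\mathrm{Regret}_T(\pi)=\sum_{i=1}^T\mathbb E\big[F_*(X_i)-Y_i(A_i)\big].$$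 Lemma. Let $\tilde C,L>0$ with $\tilde C L<1/2$ (otherwise the classes are empty). There is a constant $c>0$, depending only on $\tilde C$ and $L$, such that for all integers $T\ge1$ and $k\ge 1$ $$\inf_\pi\sup_{D\in\mathcal D(\tilde C,L)}\mathrm{Regret}_T(\pi)\ \ge\ c\,T^{2/3},\qquad \inf_\pi\sup_{D\in\mathcal D^{(k)}(\tilde C,L)}\mathrm{Regret}_T(\pi)\ \ge\ c\,\min\{\sqrt{kT},\,T^{2/3}\}.$$ In particular, the second quantity is at least $c\sqrt{kT}$ whenever $k\le T^{1/3}$. -/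

import Mathlib

open MeasureTheory ProbabilityTheory
open scoped unitInterval

noncomputable section

namespace IsotonicBandit

/-- Parameters of a two-armed contextual bandit with contexts in `[0,1]`: the mean reward
functions `F_0, F_1 : [0,1] → ℝ` of the two arms, and the law of the additive noise. -/
structure Model where
  mean : Fin 2 → I → ℝ
  noise : Measure ℝ

/-- Assumption A on the noise distribution function `F`: `|F(t) - F(0)| > C̃ |t|` for all
nonzero `t ∈ [-L, L]`. -/
def LocalGrowth (C L : ℝ) (ν : Measure ℝ) : Prop :=
  ∀ t : ℝ, t ≠ 0 → |t| ≤ L → C * |t| < |cdf ν t - cdf ν 0|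

/-- Admissible noise laws: probability measures with a finite first moment and mean zero,
symmetric around zero, satisfying Assumption A with parameters `C`, `L`. -/
structure IsNoise (C L : ℝ) (ν : Measure ℝ) : Prop where
  isProbabilityMeasure : IsProbabilityMeasure ν
  integrable : Integrable (fun e : ℝ => e) ν
  mean_zero : ∫ e, e ∂ν = 0
  symmetric : ν.map (fun e => -e) = ν
  localGrowth : LocalGrowth C L ν

/-- The isotonic functions `[0,1] → [0,1]`. -/
def isotonicFunctions : Set (I → ℝ) :=
  {F | Monotone F ∧ ∀ x, F x ∈ Set.Icc (0 : ℝ) 1}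

/-- The isotonic functions `[0,1] → [0,1]` with `k` constant pieces. The constant pieces of a
monotone function are its (interval) level sets, so their number is the number of values. -/
def isotonicPieces (k : ℕ) : Set (I → ℝ) :=
  {F | F ∈ isotonicFunctions ∧ (Set.range F).encard = k}

/-- The class `D(C̃, L)`. -/
def isotonicClass (C L : ℝ) : Set Model :=
  {D | (∀ a, D.mean a ∈ isotonicFunctions) ∧ IsNoise C L D.noise}

/-- The class `D^(k)(C̃, L)`. -/
def isotonicPiecesClass (k : ℕ) (C L : ℝ) : Set Model :=
  {D | (∀ a, D.mean a ∈ isotonicPieces k) ∧ IsNoise C L D.noise}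

/-- The joint law of `(X, (Y(0), Y(1)))`, where `X` is uniform on `[0,1]`, the noise `ε` is
independent of `X`, and `Y(a) = F_a(X) + ε`. -/
def Model.law (D : Model) : Measure (I × (Fin 2 → ℝ)) :=
  ((volume : Measure I).prod D.noise).map (fun p => (p.1, fun a => D.mean a p.1 + p.2))

/-- A possibly randomized policy. In round `t` (counted from `0`) the arm is a measurable
function of a random seed in `[0,1]`, of the contexts and observed rewards of the earlier
rounds, and of the current context. The nonrandomized policies are those ignoring the seed. -/
structure Policy where
  arm : (t : ℕ) → I → (Fin t → I × ℝ) → I → Fin 2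
  measurable_arm : ∀ t, Measurable
    (fun p : I × (Fin t → I × ℝ) × I => arm t p.1 p.2.1 p.2.2)

/-- The contexts and observed rewards of the first `t` rounds, when the policy has seed `u` and
`ω i = (X_i, (Y_i(0), Y_i(1)))`. -/
def Policy.history (π : Policy) (u : I) (ω : ℕ → I × (Fin 2 → ℝ)) : (t : ℕ) → Fin t → I × ℝ
  | 0 => Fin.elim0
  | t + 1 => Fin.snoc (π.history u ω t)
      ((ω t).1, (ω t).2 (π.arm t u (π.history u ω t) (ω t).1))

/-- The arm drawn in round `t`. -/
def Policy.action (π : Policy) (u : I) (ω : ℕ → I × (Fin 2 → ℝ)) (t : ℕ) : Fin 2 :=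
  π.arm t u (π.history u ω t) (ω t).1

/-- The law of the seed and of the i.i.d. sequence `(X_i, (Y_i(0), Y_i(1)))`; the seed is uniform
on `[0,1]` and independent of the sequence. -/
def Model.processLaw (D : Model) : Measure (I × (ℕ → I × (Fin 2 → ℝ))) :=
  (volume : Measure I).prod (Measure.infinitePi (fun _ : ℕ => D.law))

/-- The regret `∑_{i ≤ T} E[F_*(X_i) - Y_i(A_i)]` with `F_* = max(F_0, F_1)`. -/
def regret (T : ℕ) (π : Policy) (D : Model) : ℝ :=
  ∑ t ∈ Finset.range T,
    ∫ p, (max (D.mean 0 (p.2 t).1) (D.mean 1 (p.2 t).1) - (p.2 t).2 (π.action p.1 p.2 t))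
      ∂D.processLaw

/-- The minimax regret over a class of models, `inf_π sup_D Regret_T(π)`. -/
def minimaxRegret (T : ℕ) (𝒟 : Set Model) : EReal :=
  ⨅ π : Policy, ⨆ D ∈ 𝒟, (regret T π D : EReal)

end IsotonicBandit

end

/-!
Both bounds come from one family of hard instances. Fix Gaussian noise with a small variance `v`,
chosen in terms of `C` and `L` only (`exists_isNoise_gaussianReal`): its distribution function is
concave on `[0, ∞)`, so the growth condition need only be checked at `L`, where it holds for small
`v` because `C L < 1/2`.

Let `m ≤ min(k, T^(1/3))` be of the order of this minimum. Both arms follow the same increasing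
step function with `k` values, except that on each of `m` pieces of width between `1/(2m)` and
`1/m` one of the arms is raised by `δ`; the raised arms are named by `s : Fin m → Fin 2`
(`hardModel`). Take `δ` proportional to `√(m/T)`. Since `m³ ≤ T`, this is at most of the order
`1/m` of the step heights, so that the means stay monotone, with exactly `k` values.

If `s` and `s'` differ on a single piece, each round multiplies the second moment of the likelihood
ratio of the two history laws by at most `exp ((exp (δ²/v) - 1) / m) ≤ exp (2 / T)`, whatever the
policy does, because only contexts in that piece are informative
(`lintegral_exp_hardModel_le`). After at most `T` rounds the second moment is bounded by `exp 2`
(`sq_lintegral_histLaw_le`), so the two histories cannot be told apart reliably: the sum over `s`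
and `s'` of the probabilities of drawing the inferior arm on the piece is at least a constant
multiple of `1/m` (`le_errorProb_add`). Summing over rounds and pieces, and averaging over `s`,
gives an instance with regret of order `T δ`, that is `√(mT)` (`exists_le_regret_hardModel`),
which is of the order of `min(√(kT), T^(2/3))`. The bound for the full class is the case `k = T`.
-/

noncomputable section

open scoped ENNReal NNReal

namespace IsotonicBandit

/-! ### The law of the history of a policy -/

lemma measurable_snoc {α : Type*} [MeasurableSpace α] (t : ℕ) :
    Measurable (fun p : (Fin t → α) × α => (Fin.snoc p.1 p.2 : Fin (t + 1) → α)) := by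
  refine measurable_pi_lambda _ fun i => ?_
  induction i using Fin.lastCases with
  | last => simpa using measurable_snd
  | cast i =>
    simp only [Fin.snoc_castSucc]
    fun_prop

lemma Policy.measurable_history_succ (π : Policy) (t : ℕ) :
    Measurable (fun p : (I × (Fin t → I × ℝ)) × I × (Fin 2 → ℝ) =>
      (p.1.1, (Fin.snoc p.1.2 (p.2.1, p.2.2 (π.arm t p.1.1 p.1.2 p.2.1)) :
        Fin (t + 1) → I × ℝ))) := by
  have harm : Measurable (fun p : (I × (Fin t → I × ℝ)) × I × (Fin 2 → ℝ) =>
      π.arm t p.1.1 p.1.2 p.2.1) :=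
    (π.measurable_arm t).comp (f := fun p : (I × (Fin t → I × ℝ)) × I × (Fin 2 → ℝ) =>
      (p.1.1, p.1.2, p.2.1)) (by fun_prop)
  have hev : Measurable (fun p : (I × (Fin t → I × ℝ)) × I × (Fin 2 → ℝ) =>
      p.2.2 (π.arm t p.1.1 p.1.2 p.2.1)) :=
    (measurable_from_prod_countable_left (f := fun q : (Fin 2 → ℝ) × Fin 2 => q.1 q.2)
      (fun a => measurable_pi_apply a)).comp
      (measurable_snd.snd.prodMk harm)
  exact measurable_fst.fst.prodMk
    ((measurable_snoc t).comp (measurable_fst.snd.prodMk (measurable_snd.fst.prodMk hev)))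

lemma Policy.measurable_history (π : Policy) (t : ℕ) :
    Measurable (fun p : I × (ℕ → I × (Fin 2 → ℝ)) => (p.1, π.history p.1 p.2 t)) := by
  induction t with
  | zero => exact measurable_fst.prodMk (by
      convert measurable_const (a := (Fin.elim0 : Fin 0 → I × ℝ)) using 1)
  | succ t ih =>
    exact (π.measurable_history_succ t).comp
      (ih.prodMk ((measurable_pi_apply t).comp measurable_snd))

/-- The history before round `t` depends only on the first `t` rounds. -/
lemma Policy.history_congr (π : Policy) (u : I) {ω ω' : ℕ → I × (Fin 2 → ℝ)} {t : ℕ}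
    (h : ∀ i < t, ω i = ω' i) : π.history u ω t = π.history u ω' t := by
  induction t with
  | zero => rfl
  | succ t ih =>
    simp only [Policy.history]
    rw [ih fun i hi => h i (hi.trans (Nat.lt_succ_self t)), h t (Nat.lt_succ_self t)]

/-- The joint law of the seed and of the history of the first `t` rounds. -/
def Model.histLaw (D : Model) (π : Policy) (t : ℕ) : Measure (I × (Fin t → I × ℝ)) :=
  D.processLaw.map (fun p => (p.1, π.history p.1 p.2 t))

lemma Model.measurable_reward (D : Model) (hD : ∀ a, Measurable (D.mean a)) :
    Measurable (fun p : I × ℝ => (p.1, fun a => D.mean a p.1 + p.2)) :=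
  measurable_fst.prodMk (measurable_pi_lambda _ fun a =>
    ((hD a).comp measurable_fst).add measurable_snd)

lemma Model.isProbabilityMeasure_law (D : Model) [IsProbabilityMeasure D.noise]
    (hD : ∀ a, Measurable (D.mean a)) : IsProbabilityMeasure D.law :=
  Measure.isProbabilityMeasure_map (D.measurable_reward hD).aemeasurable

lemma Model.isProbabilityMeasure_histLaw (D : Model) [IsProbabilityMeasure D.law]
    (π : Policy) (t : ℕ) : IsProbabilityMeasure (D.histLaw π t) := by
  have : IsProbabilityMeasure D.processLaw := by unfold Model.processLaw; infer_instance
  exact Measure.isProbabilityMeasure_map (π.measurable_history t).aemeasurable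

/-- Under an infinite product measure, the coordinates before `t` are independent of the `t`-th. -/
lemma infinitePi_map_restrict_range_prodMk {α : Type*} [MeasurableSpace α] (μ : Measure α)
    [IsProbabilityMeasure μ] (t : ℕ) :
    (Measure.infinitePi (fun _ : ℕ => μ)).map
        (fun ω => ((fun i : Finset.range t => ω i), ω t)) =
      ((Measure.infinitePi (fun _ : ℕ => μ)).map
        (fun ω => fun i : Finset.range t => ω i)).prod μ := by
  have h := (iIndepFun_infinitePi (P := fun _ : ℕ => μ) (X := fun _ x => x)
    (fun _ => measurable_id)).indepFun_finset (Finset.range t) {t} (by simp)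
    (fun i => measurable_pi_apply i)
  have hψ : Measurable (fun f : ({t} : Finset ℕ) → α => f ⟨t, Finset.mem_singleton_self t⟩) :=
    measurable_pi_apply _
  have hr : ∀ S : Finset ℕ, Measurable (fun (ω : ℕ → α) (i : S) => ω i) := fun S => by fun_prop
  have h3 := (h.comp measurable_id hψ).map_prod_eq_prod_map_map
    (measurable_id.comp (hr _)).aemeasurable (hψ.comp (hr _)).aemeasurable
  simp only [Function.comp_def, id] at h3
  rw [h3, Measure.infinitePi_map_eval]

/-- The outcome of round `t` is independent of the seed and of the history before round `t`. -/
lemma Model.map_history_prodMk (D : Model) [IsProbabilityMeasure D.law] (π : Policy) (t : ℕ) :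
    D.processLaw.map (fun p => ((p.1, π.history p.1 p.2 t), p.2 t)) =
      (D.histLaw π t).prod D.law := by
  obtain ⟨z⟩ : Nonempty (I × (Fin 2 → ℝ)) := inferInstance
  set P := Measure.infinitePi (fun _ : ℕ => D.law) with hP
  let r : (ℕ → I × (Fin 2 → ℝ)) → (Finset.range t → I × (Fin 2 → ℝ)) := fun ω i => ω i
  let e : (Finset.range t → I × (Fin 2 → ℝ)) → (ℕ → I × (Fin 2 → ℝ)) :=
    fun f i => if h : i ∈ Finset.range t then f ⟨i, h⟩ else z
  have hr : Measurable r := by fun_prop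
  have he : Measurable e := by
    refine measurable_pi_lambda _ fun i => ?_
    by_cases h : i ∈ Finset.range t
    · simp only [e, h, dite_true]
      fun_prop
    · simp only [e, h, dite_false]
      fun_prop
  -- `g` reconstructs the history from the seed and the first `t` rounds.
  let g : I × (Finset.range t → I × (Fin 2 → ℝ)) → I × (Fin t → I × ℝ) :=
    fun p => (p.1, π.history p.1 (e p.2) t)
  have hg : Measurable g :=
    (π.measurable_history t).comp (measurable_fst.prodMk (he.comp measurable_snd))
  have hgr : ∀ p : I × (ℕ → I × (Fin 2 → ℝ)), (p.1, π.history p.1 p.2 t) = g (p.1, r p.2) := by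
    intro p
    refine Prod.ext rfl (π.history_congr _ fun i hi => ?_)
    simp [e, r, hi]
  have h1 : (fun p : I × (ℕ → I × (Fin 2 → ℝ)) => ((p.1, π.history p.1 p.2 t), p.2 t)) =
      Prod.map g id ∘ MeasurableEquiv.prodAssoc.symm ∘
        Prod.map id (fun ω => (r ω, ω t)) := by
    funext p
    exact Prod.ext (hgr p) rfl
  have h2 : (fun p : I × (ℕ → I × (Fin 2 → ℝ)) => (p.1, π.history p.1 p.2 t)) =
      g ∘ Prod.map id r := by
    funext p
    exact hgr p
  have hP1 : IsProbabilityMeasure (P.map r) := Measure.isProbabilityMeasure_map hr.aemeasurable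
  have hm : Measurable (fun ω : ℕ → I × (Fin 2 → ℝ) => (r ω, ω t)) := by fun_prop
  unfold Model.histLaw Model.processLaw
  rw [h1, h2, ← Measure.map_map (hg.prodMap measurable_id)
      (MeasurableEquiv.prodAssoc.symm.measurable.comp (measurable_id.prodMap hm)),
    ← Measure.map_map MeasurableEquiv.prodAssoc.symm.measurable (measurable_id.prodMap hm),
    ← Measure.map_map hg (measurable_id.prodMap hr),
    ← Measure.map_prod_map _ _ measurable_id hm, ← Measure.map_prod_map _ _ measurable_id hr,
    infinitePi_map_restrict_range_prodMk, Measure.map_id]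
  have h3 : ((volume : Measure I).prod ((P.map r).prod D.law)).map
      MeasurableEquiv.prodAssoc.symm = ((volume : Measure I).prod (P.map r)).prod D.law := by
    rw [← Measure.prodAssoc_prod, MeasurableEquiv.map_symm_map]
  rw [h3, ← Measure.map_prod_map _ _ hg measurable_id, Measure.map_id]

/-- The history grows by one independent outcome, observed at the arm chosen by the policy. -/
lemma Model.histLaw_succ (D : Model) [IsProbabilityMeasure D.law] (π : Policy) (t : ℕ) :
    D.histLaw π (t + 1) = ((D.histLaw π t).prod D.law).map (fun p =>
      (p.1.1, Fin.snoc p.1.2 (p.2.1, p.2.2 (π.arm t p.1.1 p.1.2 p.2.1)))) := by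
  have hm : Measurable (fun p : I × (ℕ → I × (Fin 2 → ℝ)) =>
      ((p.1, π.history p.1 p.2 t), p.2 t)) :=
    (π.measurable_history t).prodMk ((measurable_pi_apply t).comp measurable_snd)
  rw [← D.map_history_prodMk π t, Measure.map_map (π.measurable_history_succ t) hm]
  rfl

lemma Model.histLaw_zero (D : Model) [IsProbabilityMeasure D.law] (π : Policy) :
    D.histLaw π 0 = (volume : Measure I).map (fun u => (u, Fin.elim0)) := by
  have h : (volume : Measure I) = D.processLaw.map Prod.fst := by
    unfold Model.processLaw
    rw [Measure.map_fst_prod, measure_univ, one_smul]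
  conv_rhs => rw [h]
  have hm : Measurable (fun u : I => (u, (Fin.elim0 : Fin 0 → I × ℝ))) :=
    measurable_id.prodMk measurable_const
  rw [Measure.map_map hm measurable_fst]
  rfl

/-! ### Change of measure for histories -/

lemma sq_lintegral_mul_le {α : Type*} [MeasurableSpace α] (μ : Measure α) {f g : α → ℝ≥0∞}
    (hf : AEMeasurable f μ) (hg : AEMeasurable g μ) :
    (∫⁻ a, f a * g a ∂μ) ^ 2 ≤ (∫⁻ a, f a ^ 2 ∂μ) * ∫⁻ a, g a ^ 2 ∂μ := by
  have h := ENNReal.lintegral_mul_le_Lp_mul_Lq μ Real.HolderConjugate.two_two hf hg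
  have h2 := pow_le_pow_left₀ (zero_le) h 2
  simp only [Pi.mul_apply, ENNReal.rpow_two, mul_pow] at h2
  refine h2.trans_eq ?_
  congr 1 <;> rw [← ENNReal.rpow_natCast, ← ENNReal.rpow_mul] <;> norm_num

lemma gaussianPDF_shift {v : ℝ≥0} (hv : v ≠ 0) (d e : ℝ) :
    gaussianPDF d v e =
      gaussianPDF 0 v e * ENNReal.ofReal (Real.exp (e * d / v - d ^ 2 / (2 * v))) := by
  have hv' : (v : ℝ) ≠ 0 := by exact_mod_cast hv
  simp only [gaussianPDF, gaussianPDFReal]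
  rw [← ENNReal.ofReal_mul (by positivity),
    mul_assoc _ (Real.exp _) (Real.exp _), ← Real.exp_add]
  congr 3
  field_simp
  ring

lemma lintegral_gaussianReal_const_add {v : ℝ≥0} (hv : v ≠ 0) (d : ℝ) {ψ : ℝ → ℝ≥0∞}
    (hψ : Measurable ψ) :
    ∫⁻ e, ψ (d + e) ∂gaussianReal 0 v =
      ∫⁻ e, ENNReal.ofReal (Real.exp (e * d / v - d ^ 2 / (2 * v))) * ψ e ∂gaussianReal 0 v := by
  have h1 := gaussianReal_map_const_add (μ := 0) (v := v) d
  rw [zero_add] at h1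
  rw [← lintegral_map hψ (measurable_const_add d), h1, gaussianReal_of_var_ne_zero _ hv,
    gaussianReal_of_var_ne_zero _ hv,
    lintegral_withDensity_eq_lintegral_mul _ (measurable_gaussianPDF _ _) hψ,
    lintegral_withDensity_eq_lintegral_mul _ (measurable_gaussianPDF _ _) (by fun_prop)]
  simp only [Pi.mul_apply, gaussianPDF_shift hv d, mul_assoc]

/-- The second moment of the likelihood ratio of a Gaussian shift. -/
lemma lintegral_sq_likelihoodRatio {v : ℝ≥0} (hv : v ≠ 0) (d : ℝ) :
    ∫⁻ e, ENNReal.ofReal (Real.exp (e * d / v - d ^ 2 / (2 * v))) ^ 2 ∂gaussianReal 0 v =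
      ENNReal.ofReal (Real.exp (d ^ 2 / v)) := by
  have hv' : (v : ℝ) ≠ 0 := by exact_mod_cast hv
  rw [gaussianReal_of_var_ne_zero _ hv,
    lintegral_withDensity_eq_lintegral_mul _ (measurable_gaussianPDF _ _) (by fun_prop)]
  have h : ∀ e, (gaussianPDF 0 v * fun e =>
      ENNReal.ofReal (Real.exp (e * d / v - d ^ 2 / (2 * v))) ^ 2) e =
      ENNReal.ofReal (Real.exp (d ^ 2 / v)) * gaussianPDF (2 * d) v e := by
    intro e
    rw [gaussianPDF_shift hv, Pi.mul_apply, mul_left_comm, ← ENNReal.ofReal_pow (by positivity),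
      ← ENNReal.ofReal_mul (by positivity), ← Real.exp_nat_mul, ← Real.exp_add]
    congr 3
    field_simp
    push_cast
    ring
  simp_rw [h]
  rw [lintegral_const_mul _ (measurable_gaussianPDF _ _), lintegral_gaussianPDF_eq_one _ hv,
    mul_one]

/-- One-step change of measure: the outcome `(X, f X + ε)` against `(X, f' X + ε)` for Gaussian
noise `ε`. -/
lemma sq_lintegral_shift_le {X : Type*} [MeasurableSpace X] (P : Measure X) [SFinite P]
    {v : ℝ≥0} (hv : v ≠ 0) {f f' : X → ℝ} (hf : Measurable f) (hf' : Measurable f')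
    {ψ : X × ℝ → ℝ≥0∞} (hψ : Measurable ψ) :
    (∫⁻ x, ∫⁻ e, ψ (x, f' x + e) ∂gaussianReal 0 v ∂P) ^ 2 ≤
      (∫⁻ x, ENNReal.ofReal (Real.exp ((f' x - f x) ^ 2 / v)) ∂P) *
        ∫⁻ x, ∫⁻ e, ψ (x, f x + e) ^ 2 ∂gaussianReal 0 v ∂P := by
  let r : X × ℝ → ℝ≥0∞ := fun p => ENNReal.ofReal
    (Real.exp (p.2 * (f' p.1 - f p.1) / v - (f' p.1 - f p.1) ^ 2 / (2 * v)))
  have hr : Measurable r := by fun_prop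
  have hψf : Measurable fun p : X × ℝ => ψ (p.1, f p.1 + p.2) := by fun_prop
  have h1 : ∀ x, ∫⁻ e, ψ (x, f' x + e) ∂gaussianReal 0 v =
      ∫⁻ e, r (x, e) * ψ (x, f x + e) ∂gaussianReal 0 v := by
    intro x
    rw [← lintegral_gaussianReal_const_add hv (f' x - f x)
      (ψ := fun e => ψ (x, f x + e)) (by fun_prop)]
    congr with e
    congr 2
    ring
  have h2 : ∀ x, ENNReal.ofReal (Real.exp ((f' x - f x) ^ 2 / v)) =
      ∫⁻ e, r (x, e) ^ 2 ∂gaussianReal 0 v := fun x =>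
    (lintegral_sq_likelihoodRatio hv _).symm
  simp_rw [h1, h2]
  rw [← lintegral_prod (fun p => r p * ψ (p.1, f p.1 + p.2)) (hr.mul hψf).aemeasurable,
    ← lintegral_prod (fun p => r p ^ 2) (hr.pow_const 2).aemeasurable,
    ← lintegral_prod (fun p => ψ (p.1, f p.1 + p.2) ^ 2) (hψf.pow_const 2).aemeasurable]
  exact sq_lintegral_mul_le _ hr.aemeasurable hψf.aemeasurable

lemma lintegral_map_prod {α β γ : Type*} [MeasurableSpace α] [MeasurableSpace β]
    [MeasurableSpace γ] (μ : Measure α) (ν : Measure β) [SFinite ν] {F : α × β → γ}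
    (hF : Measurable F) {φ : γ → ℝ≥0∞} (hφ : Measurable φ) :
    ∫⁻ z, φ z ∂(μ.prod ν).map F = ∫⁻ x, ∫⁻ y, φ (F (x, y)) ∂ν ∂μ := by
  rw [lintegral_map hφ hF]
  exact lintegral_prod _ (hφ.comp hF).aemeasurable

lemma Model.lintegral_law (D : Model) [IsProbabilityMeasure D.noise]
    (hD : ∀ a, Measurable (D.mean a)) {φ : I × (Fin 2 → ℝ) → ℝ≥0∞} (hφ : Measurable φ) :
    ∫⁻ z, φ z ∂D.law = ∫⁻ x, ∫⁻ e, φ (x, fun a => D.mean a x + e) ∂D.noise :=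
  lintegral_map_prod _ _ (D.measurable_reward hD) hφ

lemma measurable_mean_apply {D : Model} (hD : ∀ a, Measurable (D.mean a)) {g : I → Fin 2}
    (hg : Measurable g) : Measurable fun x => D.mean (g x) x :=
  (measurable_from_prod_countable_left (f := fun q : I × Fin 2 => D.mean q.2 q.1) hD).comp
    (measurable_id.prodMk hg)

/-- Change of measure for histories. If for every arm rule `g` the one-step factor is at most `κ`,
then the likelihood ratio of the histories of length `t` has second moment at most `κ ^ t`; the
bound is stated in dual form, by testing against functions `φ`, which makes it provable by
induction on `t` however the policy adapts to the past. -/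
lemma sq_lintegral_histLaw_le {D D' : Model} {v : ℝ≥0} (hv : v ≠ 0)
    (hD : ∀ a, Measurable (D.mean a)) (hD' : ∀ a, Measurable (D'.mean a))
    (hn : D.noise = gaussianReal 0 v) (hn' : D'.noise = gaussianReal 0 v) {κ : ℝ≥0∞}
    (hκ : ∀ g : I → Fin 2, Measurable g →
      ∫⁻ x, ENNReal.ofReal (Real.exp ((D'.mean (g x) x - D.mean (g x) x) ^ 2 / v)) ≤ κ)
    (π : Policy) (t : ℕ) {φ : I × (Fin t → I × ℝ) → ℝ≥0∞} (hφ : Measurable φ) :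
    (∫⁻ p, φ p ∂D'.histLaw π t) ^ 2 ≤ κ ^ t * ∫⁻ p, φ p ^ 2 ∂D.histLaw π t := by
  have : IsProbabilityMeasure D.noise := by rw [hn]; infer_instance
  have : IsProbabilityMeasure D'.noise := by rw [hn']; infer_instance
  have := D.isProbabilityMeasure_law hD
  have := D'.isProbabilityMeasure_law hD'
  have := D.isProbabilityMeasure_histLaw π
  have := D'.isProbabilityMeasure_histLaw π
  induction t with
  | zero =>
    have := D.isProbabilityMeasure_histLaw π 0
    have h := sq_lintegral_mul_le (D.histLaw π 0) hφ.aemeasurable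
      (aemeasurable_const (b := (1 : ℝ≥0∞)))
    rw [D'.histLaw_zero, ← D.histLaw_zero π]
    simpa using h
  | succ t ih =>
    have hsucc := π.measurable_history_succ t
    -- The one-step bound for the average of `φ` over round `t`, given that the past is `p`.
    have step : ∀ p : I × (Fin t → I × ℝ),
        (∫⁻ z, φ (p.1, Fin.snoc p.2 (z.1, z.2 (π.arm t p.1 p.2 z.1))) ∂D'.law) ^ 2 ≤
        κ * ∫⁻ z, φ (p.1, Fin.snoc p.2 (z.1, z.2 (π.arm t p.1 p.2 z.1))) ^ 2 ∂D.law := by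
      intro p
      have hg : Measurable (π.arm t p.1 p.2) :=
        (π.measurable_arm t).comp (f := fun x => (p.1, p.2, x)) (by fun_prop)
      have hz : Measurable fun z : I × (Fin 2 → ℝ) =>
          φ (p.1, Fin.snoc p.2 (z.1, z.2 (π.arm t p.1 p.2 z.1))) :=
        (hφ.comp hsucc).comp (measurable_const.prodMk measurable_id)
      have hψ : Measurable fun w : I × ℝ => φ (p.1, Fin.snoc p.2 w) :=
        hφ.comp (measurable_const.prodMk
          ((measurable_snoc t).comp (measurable_const.prodMk measurable_id)))
      rw [D'.lintegral_law hD' hz, D.lintegral_law hD (hz.pow_const 2), hn, hn']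
      refine (sq_lintegral_shift_le volume hv (measurable_mean_apply hD hg)
        (measurable_mean_apply hD' hg) hψ).trans ?_
      gcongr
      exact hκ _ hg
    rw [D'.histLaw_succ, D.histLaw_succ, lintegral_map_prod _ _ hsucc hφ,
      lintegral_map_prod _ _ hsucc (hφ.pow_const 2)]
    calc _ ≤ κ ^ t * ∫⁻ p, (∫⁻ z, φ (p.1, Fin.snoc p.2 (z.1, z.2 (π.arm t p.1 p.2 z.1)))
            ∂D'.law) ^ 2 ∂D.histLaw π t := ih (hφ.comp hsucc).lintegral_prod_right'
      _ ≤ κ ^ t * ∫⁻ p, κ * ∫⁻ z, φ (p.1, Fin.snoc p.2 (z.1, z.2 (π.arm t p.1 p.2 z.1))) ^ 2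
            ∂D.law ∂D.histLaw π t := by
          gcongr with p
          exact step p
      _ = _ := by
          rw [pow_succ, mul_assoc]
          congr 1
          exact lintegral_const_mul _ ((hφ.pow_const 2).comp hsucc).lintegral_prod_right'

lemma sq_histLaw_apply_le {D D' : Model} {v : ℝ≥0} (hv : v ≠ 0)
    (hD : ∀ a, Measurable (D.mean a)) (hD' : ∀ a, Measurable (D'.mean a))
    (hn : D.noise = gaussianReal 0 v) (hn' : D'.noise = gaussianReal 0 v) {κ : ℝ≥0∞}
    (hκ : ∀ g : I → Fin 2, Measurable g →
      ∫⁻ x, ENNReal.ofReal (Real.exp ((D'.mean (g x) x - D.mean (g x) x) ^ 2 / v)) ≤ κ)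
    (π : Policy) (t : ℕ) {E : Set (I × (Fin t → I × ℝ))} (hE : MeasurableSet E) :
    D'.histLaw π t E ^ 2 ≤ κ ^ t * D.histLaw π t E := by
  have h := sq_lintegral_histLaw_le hv hD hD' hn hn' hκ π t
    (φ := E.indicator 1) (measurable_one.indicator hE)
  have hsq : ∀ p, E.indicator (1 : I × (Fin t → I × ℝ) → ℝ≥0∞) p ^ 2 = E.indicator 1 p := by
    intro p
    by_cases hp : p ∈ E <;> simp [hp]
  simpa only [hsq, lintegral_indicator_one hE] using h

/-- Two-point testing bound: a bound `K` on the second moment of the likelihood ratio bounds from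
below the sum of the two error probabilities of any test. -/
lemma inv_le_add_compl {α : Type*} [MeasurableSpace α] (P Q : Measure α)
    [IsProbabilityMeasure P] [IsProbabilityMeasure Q] {K : ℝ} (hK : 2 ≤ K) {E : Set α}
    (hE : MeasurableSet E) (h : Q E ^ 2 ≤ ENNReal.ofReal K * P E) :
    ENNReal.ofReal K⁻¹ ≤ P E + Q Eᶜ := by
  have h1 : (Q.real E) ^ 2 ≤ K * P.real E := by
    have := ENNReal.toReal_mono (ENNReal.mul_ne_top ENNReal.ofReal_ne_top (measure_ne_top _ _)) h
    rwa [ENNReal.toReal_pow, ENNReal.toReal_mul, ENNReal.toReal_ofReal (by linarith)] at this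
  have h2 : Q.real Eᶜ = 1 - Q.real E := probReal_compl_eq_one_sub hE
  have h3 : Q.real E ≤ 1 := measureReal_le_one
  have h4 : 0 ≤ Q.real E := measureReal_nonneg
  have h5 : K⁻¹ ≤ P.real E + Q.real Eᶜ := by
    rw [h2, inv_le_iff_one_le_mul₀ (by linarith)]
    nlinarith
  calc ENNReal.ofReal K⁻¹ ≤ ENNReal.ofReal (P.real E + Q.real Eᶜ) := ENNReal.ofReal_le_ofReal h5
    _ = P E + Q Eᶜ := by
      rw [ENNReal.ofReal_add measureReal_nonneg measureReal_nonneg, ofReal_measureReal,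
        ofReal_measureReal]

/-! ### Gaussian noise -/

lemma antitoneOn_gaussianPDFReal (v : ℝ≥0) :
    AntitoneOn (gaussianPDFReal 0 v) (Set.Ici 0) := by
  intro x hx y hy hxy
  simp only [gaussianPDFReal, sub_zero]
  have : x ^ 2 ≤ y ^ 2 := pow_le_pow_left₀ hx hxy 2
  gcongr

lemma cdf_gaussianReal_sub {v : ℝ≥0} (hv : v ≠ 0) (s t : ℝ) :
    cdf (gaussianReal 0 v) t - cdf (gaussianReal 0 v) s = ∫ x in s..t, gaussianPDFReal 0 v x := by
  have h0 := integrable_gaussianPDFReal 0 v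
  have h1 : ∀ t, cdf (gaussianReal 0 v) t = ∫ x in Set.Iic t, gaussianPDFReal 0 v x := by
    intro t
    rw [cdf_eq_real, Measure.real, gaussianReal_apply_eq_integral 0 hv, ENNReal.toReal_ofReal]
    exact integral_nonneg fun x => gaussianPDFReal_nonneg _ _ _
  rw [h1, h1, intervalIntegral.integral_Iic_sub_Iic h0.integrableOn h0.integrableOn]

/-- The distribution function of a centered Gaussian is concave on `[0, ∞)`; the bound at `l`
therefore extends to all `t ≤ l`. -/
lemma cdf_gaussianReal_concave {v : ℝ≥0} (hv : v ≠ 0) {t l : ℝ} (ht : 0 < t) (htl : t ≤ l) :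
    t / l * (cdf (gaussianReal 0 v) l - cdf (gaussianReal 0 v) 0) ≤
      cdf (gaussianReal 0 v) t - cdf (gaussianReal 0 v) 0 := by
  have hl : 0 < l := ht.trans_le htl
  have h0 := integrable_gaussianPDFReal 0 v
  rw [cdf_gaussianReal_sub hv, cdf_gaussianReal_sub hv]
  have h2 : ∫ x in (0 : ℝ)..l, gaussianPDFReal 0 v x =
      (l / t) * ∫ x in (0 : ℝ)..t, gaussianPDFReal 0 v ((l / t) * x) := by
    rw [← smul_eq_mul (l / t), intervalIntegral.smul_integral_comp_mul_left]
    congr 1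
    · simp
    · field_simp
  have hlt : 1 ≤ l / t := (one_le_div ht).2 htl
  have hcont : Continuous (gaussianPDFReal 0 v) := by
    unfold gaussianPDFReal; fun_prop
  rw [h2, ← mul_assoc, div_mul_div_cancel₀ hl.ne', div_self ht.ne', one_mul]
  refine intervalIntegral.integral_mono_on ht.le
    ((hcont.comp (continuous_const.mul continuous_id)).intervalIntegrable _ _)
    (hcont.intervalIntegrable _ _) fun x hx => ?_
  refine antitoneOn_gaussianPDFReal v hx.1 ?_ ?_
  · exact mul_nonneg (by positivity) hx.1
  · exact le_mul_of_one_le_left hx.1 hlt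

lemma cdf_neg_of_symmetric {ν : Measure ℝ} [IsProbabilityMeasure ν] [NullSingletonClass ν]
    (hν : ν.map (fun e => -e) = ν) (t : ℝ) : cdf ν (-t) = 1 - cdf ν t := by
  rw [cdf_eq_real, cdf_eq_real, ← probReal_compl_eq_one_sub measurableSet_Iic, Set.compl_Iic]
  conv_lhs => rw [← hν]
  rw [map_measureReal_apply measurable_neg measurableSet_Iic]
  have : (fun e : ℝ => -e) ⁻¹' Set.Iic (-t) = Set.Ici t := by ext; simp
  rw [this, measureReal_congr Ioi_ae_eq_Ici]

lemma gaussianReal_zero_map_neg (v : ℝ≥0) :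
    (gaussianReal 0 v).map (fun e => -e) = gaussianReal 0 v := by
  simp [gaussianReal_map_neg]

/-- If the growth bound holds strictly at the endpoint, then centered Gaussian noise is
admissible. -/
lemma isNoise_gaussianReal {C l : ℝ} {v : ℝ≥0} (hl : 0 < l) (hv : v ≠ 0)
    (h : C * l < cdf (gaussianReal 0 v) l - cdf (gaussianReal 0 v) 0) :
    IsNoise C l (gaussianReal 0 v) where
  isProbabilityMeasure := inferInstance
  integrable := (memLp_id_gaussianReal 1).integrable le_rfl
  mean_zero := integral_id_gaussianReal
  symmetric := gaussianReal_zero_map_neg v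
  localGrowth := by
    have := nullSingletonClass_gaussianReal (μ := 0) hv
    have key : ∀ t, 0 < t → t ≤ l →
        C * t < cdf (gaussianReal 0 v) t - cdf (gaussianReal 0 v) 0 := by
      intro t ht htl
      refine lt_of_lt_of_le ?_ (cdf_gaussianReal_concave hv ht htl)
      calc C * t = t / l * (C * l) := by field_simp
        _ < _ := by gcongr
    intro t ht0 htl
    rcases lt_or_gt_of_ne ht0 with ht | ht
    · rw [abs_of_neg ht] at htl ⊢
      have h1 := key (-t) (by linarith) htl
      have h2 := cdf_neg_of_symmetric (gaussianReal_zero_map_neg v) (-t)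
      have h3 := cdf_neg_of_symmetric (gaussianReal_zero_map_neg v) 0
      rw [neg_neg] at h2
      rw [neg_zero] at h3
      rw [abs_sub_comm]
      refine lt_of_lt_of_le ?_ (le_abs_self _)
      linarith
    · rw [abs_of_pos ht] at htl ⊢
      exact (key t ht htl).trans_le (le_abs_self _)

lemma cdf_gaussianReal_sq {r : ℝ≥0} (hr : r ≠ 0) (t : ℝ) :
    cdf (gaussianReal 0 (r ^ 2)) t = cdf (gaussianReal 0 1) (t / r) := by
  have h : gaussianReal 0 (r ^ 2) = (gaussianReal 0 1).map ((r : ℝ) * ·) := by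
    rw [gaussianReal_map_const_mul]
    congr 1
    · simp
    · ext; simp
  have hr' : (0 : ℝ) < r := by positivity
  rw [cdf_eq_real, cdf_eq_real, h, map_measureReal_apply (by fun_prop) measurableSet_Iic]
  congr 1
  ext x
  simp [le_div_iff₀ hr', mul_comm]

/-- As long as `C l < 1/2`, some centered Gaussian, with small enough variance, is admissible. -/
lemma exists_isNoise_gaussianReal {C l : ℝ} (hl : 0 < l) (hCl : C * l < 1 / 2) :
    ∃ v : ℝ≥0, v ≠ 0 ∧ IsNoise C l (gaussianReal 0 v) := by
  have := nullSingletonClass_gaussianReal (μ := 0) (one_ne_zero : (1 : ℝ≥0) ≠ 0)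
  have h0 : cdf (gaussianReal 0 1) 0 = 1 / 2 := by
    have := cdf_neg_of_symmetric (gaussianReal_zero_map_neg 1) 0
    rw [neg_zero] at this
    linarith
  obtain ⟨y, hy, hy0⟩ := (((tendsto_cdf_atTop (gaussianReal 0 1)).eventually_const_lt
    (show C * l + 1 / 2 < 1 by linarith)).and (Filter.eventually_gt_atTop 0)).exists
  let r : ℝ≥0 := ⟨l / y, by positivity⟩
  have hr : r ≠ 0 := by
    have : (0 : ℝ) < l / y := by positivity
    exact fun h => this.ne' (congrArg NNReal.toReal h)
  refine ⟨r ^ 2, pow_ne_zero 2 hr, isNoise_gaussianReal hl (pow_ne_zero 2 hr) ?_⟩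
  rw [cdf_gaussianReal_sq hr, cdf_gaussianReal_sq hr, zero_div, h0]
  have : l / (r : ℝ) = y := by
    change l / (l / y) = y
    field_simp
  rw [this]
  linarith

/-! ### The hard instances -/

/-- A continuous increasing function on `[0, 1]` whose integer crossings delimit the constant
pieces. It is `m x` up to `(m - 1/2)/m`, so that the first `m` pieces have widths between `1/(2m)`
and `1/m`; beyond that point it is steep enough to fit in `k` pieces. -/
def ramp (m k : ℕ) (x : ℝ) : ℝ := m * x + 2 * k * max 0 (m * x - (m - 1 / 2))

/-- The index, in `{0, …, k - 1}`, of the constant piece that contains `x`. -/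
def piece (m k : ℕ) (x : I) : ℕ := min ⌊ramp m k x⌋₊ (k - 1)

lemma ramp_mono (m k : ℕ) : Monotone (ramp m k) := by
  intro x y h
  unfold ramp
  gcongr

lemma piece_mono (m k : ℕ) : Monotone (piece m k) := fun _ _ h =>
  min_le_min_right _ (Nat.floor_le_floor (ramp_mono m k h))

lemma piece_lt {m k : ℕ} (hk : 0 < k) (x : I) : piece m k x < k :=
  (min_le_right _ _).trans_lt (Nat.sub_lt hk one_pos)

lemma exists_piece_eq {m k j : ℕ} (hm : 0 < m) (hj : j < k) : ∃ x, piece m k x = j := by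
  have hm' : (1 : ℝ) ≤ m := by exact_mod_cast hm
  have hjk : (j : ℝ) ≤ k := by exact_mod_cast hj.le
  have hc : ContinuousOn (ramp m k) (Set.Icc 0 1) := by
    unfold ramp; fun_prop
  have h0 : ramp m k 0 = 0 := by
    rw [ramp, max_eq_left (by linarith)]
    simp
  have h1 : ramp m k 1 = m + k := by
    rw [ramp, max_eq_right (by linarith)]
    ring
  obtain ⟨x, hx, hxj⟩ := intermediate_value_Icc zero_le_one hc
    (show (j : ℝ) ∈ Set.Icc (ramp m k 0) (ramp m k 1) by
      rw [h0, h1]; exact ⟨Nat.cast_nonneg j, by linarith⟩)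
  refine ⟨⟨x, hx⟩, ?_⟩
  simp only [piece, hxj, Nat.floor_natCast]
  omega

lemma measurable_piece (m k : ℕ) : Measurable (piece m k) := (piece_mono m k).measurable

lemma measurableSet_piece_eq (m k j : ℕ) : MeasurableSet {x | piece m k x = j} :=
  measurable_piece m k (measurableSet_singleton j)

lemma volume_piece_le {m k j : ℕ} (hj : j < m) (hmk : m ≤ k) :
    (volume {x | piece m k x = j}) ≤ ENNReal.ofReal (1 / m) := by
  have hm : (0 : ℝ) < m := by exact_mod_cast (Nat.zero_le j).trans_lt hj
  have hj' : (j : ℝ) + 1 ≤ m := by exact_mod_cast hj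
  have hj0 : (0 : ℝ) ≤ j := Nat.cast_nonneg j
  have ha : (j : ℝ) / m ∈ I := ⟨by positivity, (div_le_one hm).2 (by linarith)⟩
  have hb : ((j : ℝ) + 1) / m ∈ I := ⟨by positivity, (div_le_one hm).2 hj'⟩
  have hsub : {x | piece m k x = j} ⊆ Set.Icc (⟨_, ha⟩ : I) ⟨_, hb⟩ := by
    intro x hx
    have hx' : min ⌊ramp m k x⌋₊ (k - 1) = j := hx
    have hx0 := x.2.1
    have hmx : (m : ℝ) * x ≤ m := mul_le_of_le_one_right hm.le x.2.2
    have hramp : (m : ℝ) * x ≤ ramp m k x := by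
      unfold ramp
      exact le_add_of_nonneg_right (by positivity)
    constructor
    · change (j : ℝ) / m ≤ x
      rw [div_le_iff₀' hm]
      rcases le_total ((m : ℝ) * x - (m - 1 / 2)) 0 with h | h
      · have h2 : ramp m k x = m * x := by
          rw [ramp, max_eq_left h]
          ring
        rw [h2] at hx'
        have h3 : j ≤ ⌊(m : ℝ) * x⌋₊ := by omega
        exact (Nat.le_floor_iff (by positivity)).1 h3
      · linarith
    · change (x : ℝ) ≤ (j + 1) / m
      rw [le_div_iff₀' hm]
      by_cases h : j < k - 1
      · have h3 : ⌊ramp m k x⌋₊ < j + 1 := by omega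
        have h4 := (Nat.floor_lt' (Nat.succ_ne_zero j)).1 h3
        push_cast at h4
        linarith
      · have : j + 1 = m := by omega
        have : (j : ℝ) + 1 = m := by exact_mod_cast this
        linarith
  refine (measure_mono hsub).trans_eq ?_
  rw [unitInterval.volume_Icc]
  congr 1
  change ((j : ℝ) + 1) / m - j / m = 1 / m
  ring

lemma le_volume_piece {m k j : ℕ} (hj : j < m) (hmk : m ≤ k) :
    ENNReal.ofReal (1 / (2 * m)) ≤ volume {x | piece m k x = j} := by
  have hm : (0 : ℝ) < m := by exact_mod_cast (Nat.zero_le j).trans_lt hj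
  have hj' : (j : ℝ) + 1 ≤ m := by exact_mod_cast hj
  have hj0 : (0 : ℝ) ≤ j := Nat.cast_nonneg j
  have ha : (j : ℝ) / m ∈ I := ⟨by positivity, (div_le_one hm).2 (by linarith)⟩
  have hb : ((j : ℝ) + 1 / 2) / m ∈ I := ⟨by positivity, (div_le_one hm).2 (by linarith)⟩
  have hsub : Set.Ico (⟨_, ha⟩ : I) ⟨_, hb⟩ ⊆ {x | piece m k x = j} := by
    intro x hx
    have h1 : (j : ℝ) / m ≤ x := hx.1
    have h2 : (x : ℝ) < (j + 1 / 2) / m := hx.2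
    rw [div_le_iff₀' hm] at h1
    rw [lt_div_iff₀' hm] at h2
    have h3 : ramp m k x = m * x := by
      rw [ramp, max_eq_left (by linarith)]
      ring
    have h4 : ⌊(m : ℝ) * x⌋₊ = j := by
      rw [Nat.floor_eq_iff (by linarith)]
      exact ⟨h1, by linarith⟩
    change min ⌊ramp m k x⌋₊ (k - 1) = j
    rw [h3, h4]
    omega
  refine le_trans (le_of_eq ?_) (measure_mono hsub)
  rw [unitInterval.volume_Ico]
  congr 1
  change 1 / (2 * (m : ℝ)) = (j + 1 / 2) / m - j / m
  field_simp
  ring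

/-- The value of arm `a` on the piece with index `j`. On each of the first `m` pieces, arm `s j`
is better by `δ`; on the other pieces the arms agree. -/
def level (m k : ℕ) (δ : ℝ) (s : Fin m → Fin 2) (a : Fin 2) (j : ℕ) : ℝ :=
  if h : j < m then j / (2 * m) + (if s ⟨j, h⟩ = a then δ else 0) else 1 / 2 + j / (2 * k)

lemma level_bounds_of_lt {m k : ℕ} {δ : ℝ} (hδ : 0 ≤ δ) (s : Fin m → Fin 2) (a : Fin 2) {j : ℕ}
    (hj : j < m) : (j : ℝ) / (2 * m) ≤ level m k δ s a j ∧
      level m k δ s a j ≤ j / (2 * m) + δ := by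
  rw [level, dif_pos hj]
  split_ifs <;> constructor <;> linarith

lemma level_strictMono {m k : ℕ} {δ : ℝ} (hk : 0 < k) (hδ : 0 ≤ δ)
    (hδm : δ ≤ 1 / (4 * m)) (s : Fin m → Fin 2) (a : Fin 2) :
    StrictMono (level m k δ s a) := by
  intro i j hij
  have hk' : (0 : ℝ) < k := by exact_mod_cast hk
  have hij' : (i : ℝ) + 1 ≤ j := by exact_mod_cast hij
  by_cases hi : i < m
  · have hm : (0 : ℝ) < m := by exact_mod_cast (Nat.zero_le i).trans_lt hi
    have hgap : δ < 1 / (2 * m) :=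
      hδm.trans_lt (by rw [div_lt_div_iff₀ (by positivity) (by positivity)]; linarith)
    have h1 := (level_bounds_of_lt (k := k) hδ s a hi).2
    by_cases hj : j < m
    · have h2 := (level_bounds_of_lt (k := k) hδ s a hj).1
      have h3 : ((i : ℝ) + 1) / (2 * m) ≤ j / (2 * m) := by gcongr
      rw [add_div] at h3
      linarith
    · have h2 : level m k δ s a j = 1 / 2 + j / (2 * k) := by rw [level, dif_neg hj]
      have h3 : ((i : ℝ) + 1) / (2 * m) ≤ 1 / 2 := by
        have : (i : ℝ) + 1 ≤ m := by exact_mod_cast hi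
        rw [div_le_div_iff₀ (by positivity) (by positivity)]
        linarith
      rw [add_div] at h3
      have : (0 : ℝ) ≤ j / (2 * k) := by positivity
      linarith
  · have hj : ¬ j < m := by omega
    rw [level, dif_neg hi, level, dif_neg hj]
    gcongr

lemma level_mem_Icc {m k : ℕ} {δ : ℝ} (hδ : 0 ≤ δ)
    (hδm : δ ≤ 1 / (4 * m)) (s : Fin m → Fin 2) (a : Fin 2) {j : ℕ} (hj : j < k) :
    level m k δ s a j ∈ Set.Icc (0 : ℝ) 1 := by
  have hk' : (0 : ℝ) < k := by exact_mod_cast (Nat.zero_le j).trans_lt hj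
  by_cases hi : j < m
  · have hm : (0 : ℝ) < m := by exact_mod_cast (Nat.zero_le j).trans_lt hi
    obtain ⟨h1, h2⟩ := level_bounds_of_lt (k := k) hδ s a hi
    have h3 : (j : ℝ) / (2 * m) ≤ 1 / 2 := by
      have : (j : ℝ) ≤ m := by exact_mod_cast hi.le
      rw [div_le_div_iff₀ (by positivity) (by positivity)]
      linarith
    have h4 : (1 : ℝ) / (4 * m) ≤ 1 / 4 := by
      have : (1 : ℝ) ≤ m := by exact_mod_cast (Nat.zero_le j).trans_lt hi
      rw [div_le_div_iff₀ (by positivity) (by positivity)]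
      linarith
    exact ⟨le_trans (by positivity) h1, by linarith⟩
  · rw [level, dif_neg hi]
    have h3 : (j : ℝ) / (2 * k) ≤ 1 / 2 := by
      have : (j : ℝ) ≤ k := by exact_mod_cast hj.le
      rw [div_le_div_iff₀ (by positivity) (by positivity)]
      linarith
    exact ⟨by positivity, by linarith⟩

/-- The hard instance indexed by `s`, which names the better arm on each of the first `m`
pieces; the noise is Gaussian with variance `v`. -/
def hardModel (m k : ℕ) (δ : ℝ) (v : ℝ≥0) (s : Fin m → Fin 2) : Model where
  mean a x := level m k δ s a (piece m k x)
  noise := gaussianReal 0 v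

lemma hardModel_mem_isotonicPieces {m k : ℕ} {δ : ℝ} {v : ℝ≥0} (hm : 0 < m) (hk : 0 < k)
    (hδ : 0 ≤ δ) (hδm : δ ≤ 1 / (4 * m)) (s : Fin m → Fin 2) (a : Fin 2) :
    (hardModel m k δ v s).mean a ∈ isotonicPieces k := by
  have hmono := level_strictMono (k := k) hk hδ hδm s a
  refine ⟨⟨hmono.monotone.comp (piece_mono m k), fun x =>
    level_mem_Icc hδ hδm s a (piece_lt hk x)⟩, ?_⟩
  have hrange : Set.range (piece m k) = Set.Iio k := by
    ext j
    exact ⟨fun ⟨x, hx⟩ => hx ▸ piece_lt hk x, fun hj => exists_piece_eq hm hj⟩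
  change (Set.range (level m k δ s a ∘ piece m k)).encard = k
  rw [Set.range_comp, hmono.injective.encard_image, hrange, ← Finset.coe_Iio,
    Set.encard_coe_eq_coe_finsetCard, Nat.card_Iio]

lemma measurable_hardModel_mean (m k : ℕ) (δ : ℝ) (v : ℝ≥0) (s : Fin m → Fin 2) (a : Fin 2) :
    Measurable ((hardModel m k δ v s).mean a) :=
  (measurable_from_top (f := level m k δ s a)).comp (measurable_piece m k)

lemma level_update_of_ne {m k : ℕ} {δ : ℝ} (s : Fin m → Fin 2) (j : Fin m) (b a : Fin 2) {i : ℕ}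
    (hi : i ≠ j) : level m k δ (Function.update s j b) a i = level m k δ s a i := by
  unfold level
  split_ifs with h h1 h2 h2 <;> try rfl
  all_goals
    rw [Function.update_of_ne (by rintro rfl; exact hi rfl)] at h1
    contradiction

lemma abs_level_sub_le {m k : ℕ} {δ : ℝ} (hδ : 0 ≤ δ) (s s' : Fin m → Fin 2) (a : Fin 2)
    (i : ℕ) : |level m k δ s' a i - level m k δ s a i| ≤ δ := by
  by_cases h : i < m
  · obtain ⟨h1, h2⟩ := level_bounds_of_lt (k := k) hδ s a h
    obtain ⟨h3, h4⟩ := level_bounds_of_lt (k := k) hδ s' a h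
    rw [abs_le]
    constructor <;> linarith
  · simpa [level, h] using hδ

/-- One round distinguishes two hard instances that differ on a single piece only if the context
falls into that piece, which has probability at most `1/m`. -/
lemma lintegral_exp_hardModel_le {m k : ℕ} {δ : ℝ} {v : ℝ≥0} (hδ : 0 ≤ δ) (hmk : m ≤ k)
    (s : Fin m → Fin 2) (j : Fin m) (b : Fin 2) (g : I → Fin 2) :
    ∫⁻ x, ENNReal.ofReal (Real.exp (((hardModel m k δ v (Function.update s j b)).mean (g x) x -
        (hardModel m k δ v s).mean (g x) x) ^ 2 / v)) ≤
      ENNReal.ofReal (Real.exp ((Real.exp (δ ^ 2 / v) - 1) / m)) := by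
  set B : Set I := {x | piece m k x = j} with hB
  have hm : (0 : ℝ) < m := by exact_mod_cast (Nat.zero_le _).trans_lt j.2
  have hu : 0 ≤ Real.exp (δ ^ 2 / v) - 1 := by
    have := Real.add_one_le_exp (δ ^ 2 / v)
    have : 0 ≤ δ ^ 2 / v := by positivity
    linarith
  have hpt : ∀ x, ENNReal.ofReal (Real.exp (((hardModel m k δ v (Function.update s j b)).mean
      (g x) x - (hardModel m k δ v s).mean (g x) x) ^ 2 / v)) ≤
      1 + B.indicator (fun _ => ENNReal.ofReal (Real.exp (δ ^ 2 / v) - 1)) x := by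
    intro x
    by_cases hx : x ∈ B
    · rw [Set.indicator_of_mem hx, ← ENNReal.ofReal_one, ← ENNReal.ofReal_add zero_le_one hu]
      refine ENNReal.ofReal_le_ofReal ?_
      rw [add_sub_cancel]
      refine Real.exp_le_exp.2 ?_
      gcongr ?_ / _
      exact sq_le_sq' (abs_le.1 (abs_level_sub_le hδ s _ _ _)).1
        (abs_le.1 (abs_level_sub_le hδ s _ _ _)).2
    · have : (hardModel m k δ v (Function.update s j b)).mean (g x) x =
          (hardModel m k δ v s).mean (g x) x := level_update_of_ne s j b _ hx
      simp [this]
  refine (lintegral_mono hpt).trans ?_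
  rw [lintegral_add_left measurable_const, lintegral_const, measure_univ, mul_one,
    lintegral_indicator_const (measurableSet_piece_eq m k j)]
  calc (1 : ℝ≥0∞) + ENNReal.ofReal (Real.exp (δ ^ 2 / v) - 1) * volume B
      ≤ 1 + ENNReal.ofReal (Real.exp (δ ^ 2 / v) - 1) * ENNReal.ofReal (1 / m) := by
        gcongr
        exact volume_piece_le j.2 hmk
    _ = ENNReal.ofReal ((Real.exp (δ ^ 2 / v) - 1) / m + 1) := by
        rw [← ENNReal.ofReal_mul hu, mul_one_div, add_comm, ← ENNReal.ofReal_one,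
          ← ENNReal.ofReal_add (by positivity) zero_le_one]
    _ ≤ _ := ENNReal.ofReal_le_ofReal (Real.add_one_le_exp _)

/-! ### Regret on the hard instances -/

/-- The noise does not enter the regret: it is centered, and independent of the choice made in its
round. -/
lemma integral_regret_eq {D : Model} [IsProbabilityMeasure D.noise]
    (hD : ∀ a, Measurable (D.mean a)) (hb : ∀ a x, D.mean a x ∈ Set.Icc (0 : ℝ) 1)
    (hint : Integrable (fun e : ℝ => e) D.noise) (h0 : ∫ e, e ∂D.noise = 0)
    (π : Policy) (t : ℕ) :
    ∫ p, (max (D.mean 0 (p.2 t).1) (D.mean 1 (p.2 t).1) - (p.2 t).2 (π.action p.1 p.2 t))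
      ∂D.processLaw =
    ∫ q, (max (D.mean 0 q.2) (D.mean 1 q.2) - D.mean (π.arm t q.1.1 q.1.2 q.2) q.2)
      ∂((D.histLaw π t).prod volume) := by
  have := D.isProbabilityMeasure_law hD
  have := D.isProbabilityMeasure_histLaw π t
  have harm := π.measurable_arm t
  have hev : Measurable (fun q : (Fin 2 → ℝ) × Fin 2 => q.1 q.2) :=
    measurable_from_prod_countable_left fun a => measurable_pi_apply a
  have hmean : Measurable (fun q : I × Fin 2 => D.mean q.2 q.1) :=
    measurable_from_prod_countable_left hD
  have hm0 := hD 0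
  have hm1 := hD 1
  let Ψ : (I × (Fin t → I × ℝ)) × I × (Fin 2 → ℝ) → ℝ := fun w =>
    max (D.mean 0 w.2.1) (D.mean 1 w.2.1) - w.2.2 (π.arm t w.1.1 w.1.2 w.2.1)
  have hΨ : Measurable Ψ := by
    refine Measurable.sub (by fun_prop) (hev.comp (measurable_snd.snd.prodMk
      (harm.comp (f := fun w : (I × (Fin t → I × ℝ)) × I × (Fin 2 → ℝ) =>
        (w.1.1, w.1.2, w.2.1)) (by fun_prop))))
  let gap : (I × (Fin t → I × ℝ)) × I → ℝ := fun q =>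
    max (D.mean 0 q.2) (D.mean 1 q.2) - D.mean (π.arm t q.1.1 q.1.2 q.2) q.2
  have hgap : Measurable gap := by
    refine Measurable.sub (by fun_prop) (hmean.comp (measurable_snd.prodMk
      (harm.comp (f := fun w : (I × (Fin t → I × ℝ)) × I =>
        (w.1.1, w.1.2, w.2)) (by fun_prop))))
  have hgapint : Integrable gap ((D.histLaw π t).prod volume) := by
    refine Integrable.of_bound hgap.aestronglyMeasurable 1 (Filter.Eventually.of_forall fun q => ?_)
    have h1 := hb 0 q.2
    have h2 := hb 1 q.2
    have h3 := hb (π.arm t q.1.1 q.1.2 q.2) q.2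
    have h4 : max (D.mean 0 q.2) (D.mean 1 q.2) ≤ 1 := max_le h1.2 h2.2
    have h5 : 0 ≤ max (D.mean 0 q.2) (D.mean 1 q.2) := h1.1.trans (le_max_left _ _)
    rw [Real.norm_eq_abs, abs_le]
    constructor <;> simp only [gap] <;> linarith [h3.1, h3.2]
  have hhist : Measurable (fun p : I × (ℕ → I × (Fin 2 → ℝ)) =>
      ((p.1, π.history p.1 p.2 t), p.2 t)) :=
    (π.measurable_history t).prodMk ((measurable_pi_apply t).comp measurable_snd)
  calc _ = ∫ p, Ψ ((p.1, π.history p.1 p.2 t), p.2 t) ∂D.processLaw := rfl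
    _ = ∫ w, Ψ w ∂((D.histLaw π t).prod D.law) := by
      rw [← D.map_history_prodMk π t,
        integral_map hhist.aemeasurable hΨ.aestronglyMeasurable]
    _ = ∫ w, (gap w.1 - w.2) ∂(((D.histLaw π t).prod volume).prod D.noise) := by
      have hr := D.measurable_reward hD
      have h1 : (D.histLaw π t).prod D.law =
          ((D.histLaw π t).prod ((volume : Measure I).prod D.noise)).map
            (Prod.map id (fun p : I × ℝ => (p.1, fun a => D.mean a p.1 + p.2))) := by
        rw [← Measure.map_prod_map _ _ measurable_id hr, Measure.map_id]
        rfl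
      rw [h1, ← Measure.prodAssoc_prod, integral_map (measurable_id.prodMap hr).aemeasurable
        hΨ.aestronglyMeasurable, integral_map_equiv]
      refine integral_congr_ae (Filter.Eventually.of_forall fun w => ?_)
      simp only [Ψ, gap, Prod.map, MeasurableEquiv.prodAssoc, MeasurableEquiv.coe_mk,
        Equiv.prodAssoc_apply, id]
      ring
    _ = ∫ q, gap q ∂((D.histLaw π t).prod volume) := by
      rw [integral_sub (hgapint.comp_fst _) (hint.comp_snd _), integral_fun_fst,
        integral_fun_snd (fun e : ℝ => e), h0]
      simp

/-- The probability that in round `t` the context falls into the `j`-th piece and the policy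
chooses the inferior arm. -/
def errorProb (m k : ℕ) (δ : ℝ) (v : ℝ≥0) (π : Policy) (t : ℕ) (s : Fin m → Fin 2)
    (j : Fin m) : ℝ≥0∞ :=
  ∫⁻ x in {x | piece m k x = j},
    (hardModel m k δ v s).histLaw π t {p | π.arm t p.1 p.2 x ≠ s j}

lemma Policy.measurableSet_arm_ne (π : Policy) (t : ℕ) (b : Fin 2) :
    MeasurableSet {w : (I × (Fin t → I × ℝ)) × I | π.arm t w.1.1 w.1.2 w.2 ≠ b} := by
  have h : Measurable fun w : (I × (Fin t → I × ℝ)) × I => π.arm t w.1.1 w.1.2 w.2 :=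
    (π.measurable_arm t).comp (f := fun w : (I × (Fin t → I × ℝ)) × I => (w.1.1, w.1.2, w.2))
      (by fun_prop)
  exact h (measurableSet_singleton b).compl

instance (m k : ℕ) (δ : ℝ) (v : ℝ≥0) (s : Fin m → Fin 2) :
    IsProbabilityMeasure (hardModel m k δ v s).noise :=
  inferInstanceAs (IsProbabilityMeasure (gaussianReal 0 v))

instance (m k : ℕ) (δ : ℝ) (v : ℝ≥0) (s : Fin m → Fin 2) :
    IsProbabilityMeasure (hardModel m k δ v s).law :=
  Model.isProbabilityMeasure_law _ (measurable_hardModel_mean m k δ v s)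

instance (m k : ℕ) (δ : ℝ) (v : ℝ≥0) (s : Fin m → Fin 2) (π : Policy) (t : ℕ) :
    IsProbabilityMeasure ((hardModel m k δ v s).histLaw π t) :=
  Model.isProbabilityMeasure_histLaw _ _ _

/-- The set of pairs of a past and a context in the `j`-th piece for which the policy chooses the
inferior arm. -/
def errorSet (m k : ℕ) (π : Policy) (t : ℕ) (s : Fin m → Fin 2) (j : Fin m) :
    Set ((I × (Fin t → I × ℝ)) × I) :=
  {w | piece m k w.2 = j ∧ π.arm t w.1.1 w.1.2 w.2 ≠ s j}

lemma measurableSet_errorSet (m k : ℕ) (π : Policy) (t : ℕ) (s : Fin m → Fin 2) (j : Fin m) :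
    MeasurableSet (errorSet m k π t s j) :=
  (measurable_snd (measurableSet_piece_eq m k j)).inter (π.measurableSet_arm_ne t (s j))

lemma errorProb_eq (m k : ℕ) (δ : ℝ) (v : ℝ≥0) (π : Policy) (t : ℕ) (s : Fin m → Fin 2)
    (j : Fin m) : errorProb m k δ v π t s j =
      ((hardModel m k δ v s).histLaw π t).prod volume (errorSet m k π t s j) := by
  rw [Measure.prod_apply_symm (measurableSet_errorSet m k π t s j), errorProb,
    ← lintegral_indicator (measurableSet_piece_eq m k j)]
  congr with x
  by_cases hx : piece m k x = j
  · rw [Set.indicator_of_mem (by exact hx)]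
    congr 1
    ext p
    simp [errorSet, hx]
  · rw [Set.indicator_of_notMem (by exact hx)]
    simp [errorSet, hx]

lemma hardModel_gap_eq (m k : ℕ) {δ : ℝ} (hδ : 0 ≤ δ) (v : ℝ≥0) (π : Policy) (t : ℕ)
    (s : Fin m → Fin 2) (w : (I × (Fin t → I × ℝ)) × I) :
    max ((hardModel m k δ v s).mean 0 w.2) ((hardModel m k δ v s).mean 1 w.2) -
        (hardModel m k δ v s).mean (π.arm t w.1.1 w.1.2 w.2) w.2 =
      ∑ j : Fin m, (errorSet m k π t s j).indicator (fun _ => δ) w := by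
  simp only [hardModel]
  by_cases h : piece m k w.2 < m
  · rw [Finset.sum_eq_single ⟨piece m k w.2, h⟩]
    · have h2 : ∀ a b : Fin 2, max (if b = 0 then δ else 0) (if b = 1 then δ else 0) -
          (if b = a then δ else 0) = if a ≠ b then δ else 0 := by
        intro a b
        fin_cases a <;> fin_cases b <;> simp [hδ]
      simp only [level, dif_pos h, max_add_add_left, add_sub_add_left_eq_sub, h2]
      simp [Set.indicator_apply, errorSet]
    · intro j _ hj
      refine Set.indicator_of_notMem (fun hw => hj ?_) _
      exact Fin.ext hw.1.symm
    · simp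
  · rw [Finset.sum_eq_zero]
    · simp [level, h]
    · intro j _
      refine Set.indicator_of_notMem (fun hw => h ?_) _
      rw [hw.1]
      exact j.2

lemma regret_hardModel {m k : ℕ} {δ : ℝ} (v : ℝ≥0) (hk : 0 < k) (hδ : 0 ≤ δ)
    (hδm : δ ≤ 1 / (4 * m)) (π : Policy) (T : ℕ) (s : Fin m → Fin 2) :
    regret T π (hardModel m k δ v s) =
      ∑ t ∈ Finset.range T, ∑ j, δ * (errorProb m k δ v π t s j).toReal := by
  refine Finset.sum_congr rfl fun t _ => ?_
  rw [integral_regret_eq (measurable_hardModel_mean m k δ v s)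
    (fun a x => level_mem_Icc hδ hδm s a (piece_lt hk x))
    ((memLp_id_gaussianReal 1).integrable le_rfl) integral_id_gaussianReal]
  simp_rw [hardModel_gap_eq m k hδ v π t s]
  rw [integral_finsetSum _ fun j _ => (integrable_const δ).indicator
    (measurableSet_errorSet m k π t s j)]
  refine Finset.sum_congr rfl fun j _ => ?_
  rw [integral_indicator_const _ (measurableSet_errorSet m k π t s j), smul_eq_mul, mul_comm,
    errorProb_eq]
  rfl

lemma errorProb_ne_top (m k : ℕ) (δ : ℝ) (v : ℝ≥0) (π : Policy) (t : ℕ) (s : Fin m → Fin 2)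
    (j : Fin m) : errorProb m k δ v π t s j ≠ ∞ := by
  rw [errorProb_eq]
  exact measure_ne_top _ _

/-- For two instances that differ on the `j`-th piece only, the policy errs on this piece with
substantial probability in one of them. -/
lemma le_errorProb_add {m k T : ℕ} {δ : ℝ} {v : ℝ≥0} (hv : v ≠ 0) (hmk : m ≤ k)
    (hmT : m ≤ T) (hδ : 0 ≤ δ) (hδv : δ ^ 2 / v ≤ m / T) (π : Policy) {t : ℕ} (ht : t ≤ T)
    (s : Fin m → Fin 2) (j : Fin m) :
    (Real.exp 2)⁻¹ / (2 * m) ≤ (errorProb m k δ v π t s j).toReal +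
      (errorProb m k δ v π t (Function.update s j (s j + 1)) j).toReal := by
  have hm0 : 0 < m := (Nat.zero_le _).trans_lt j.2
  have hm : (0 : ℝ) < m := by exact_mod_cast hm0
  have hT : (0 : ℝ) < T := by exact_mod_cast hm0.trans_le hmT
  set s' := Function.update s j (s j + 1) with hs'
  have hs'j : s' j = s j + 1 := Function.update_self ..
  have hu0 : 0 ≤ δ ^ 2 / v := by positivity
  have hu1 : δ ^ 2 / v ≤ 1 := hδv.trans ((div_le_one hT).2 (by exact_mod_cast hmT))
  have hexp : Real.exp (δ ^ 2 / v) - 1 ≤ 2 * (m / T) := by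
    have := Real.abs_exp_sub_one_le (x := δ ^ 2 / v) (by rwa [abs_of_nonneg hu0])
    rw [abs_of_nonneg hu0] at this
    linarith [le_abs_self (Real.exp (δ ^ 2 / v) - 1)]
  have hK : ENNReal.ofReal (Real.exp ((Real.exp (δ ^ 2 / v) - 1) / m)) ^ t ≤
      ENNReal.ofReal (Real.exp 2) := by
    rw [← ENNReal.ofReal_pow (by positivity), ← Real.exp_nat_mul]
    refine ENNReal.ofReal_le_ofReal (Real.exp_le_exp.2 ?_)
    calc (t : ℝ) * ((Real.exp (δ ^ 2 / v) - 1) / m) ≤ t * (2 * (m / T) / m) := by gcongr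
      _ ≤ T * (2 * (m / T) / m) := by gcongr
      _ = 2 := by field_simp
  have htest : ∀ x : I, ENNReal.ofReal (Real.exp 2)⁻¹ ≤
      (hardModel m k δ v s).histLaw π t {p | π.arm t p.1 p.2 x ≠ s j} +
        (hardModel m k δ v s').histLaw π t {p | π.arm t p.1 p.2 x ≠ s' j} := by
    intro x
    have hE : MeasurableSet {p : I × (Fin t → I × ℝ) | π.arm t p.1 p.2 x ≠ s j} :=
      measurable_prodMk_right (π.measurableSet_arm_ne t (s j))
    have hcompl : {p : I × (Fin t → I × ℝ) | π.arm t p.1 p.2 x ≠ s' j} =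
        {p : I × (Fin t → I × ℝ) | π.arm t p.1 p.2 x ≠ s j}ᶜ := by
      ext p
      have : ∀ a b : Fin 2, a ≠ b + 1 ↔ ¬ a ≠ b := by decide
      simpa [hs'j] using this _ _
    rw [hcompl]
    refine inv_le_add_compl _ _ (by linarith [Real.add_one_le_exp (2 : ℝ)]) hE ?_
    exact (sq_histLaw_apply_le hv (measurable_hardModel_mean m k δ v s)
      (measurable_hardModel_mean m k δ v s') rfl rfl
      (fun g _ => lintegral_exp_hardModel_le hδ hmk s j (s j + 1) g) π t hE).trans (by gcongr)
  have hmeas : ∀ s : Fin m → Fin 2, Measurable fun x =>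
      (hardModel m k δ v s).histLaw π t {p | π.arm t p.1 p.2 x ≠ s j} := fun s =>
    measurable_measure_prodMk_right (π.measurableSet_arm_ne t (s j))
  have hsum : ENNReal.ofReal ((Real.exp 2)⁻¹ / (2 * m)) ≤
      errorProb m k δ v π t s j + errorProb m k δ v π t s' j := by
    calc ENNReal.ofReal ((Real.exp 2)⁻¹ / (2 * m))
        = ENNReal.ofReal (Real.exp 2)⁻¹ * ENNReal.ofReal (1 / (2 * m)) := by
          rw [← ENNReal.ofReal_mul (by positivity), mul_one_div]
      _ ≤ ENNReal.ofReal (Real.exp 2)⁻¹ * volume {x | piece m k x = j} := by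
          gcongr
          exact le_volume_piece j.2 hmk
      _ = ∫⁻ _ in {x | piece m k x = j}, ENNReal.ofReal (Real.exp 2)⁻¹ := by
          rw [setLIntegral_const]
      _ ≤ _ := by
          rw [errorProb, errorProb, ← lintegral_add_left (hmeas s)]
          exact lintegral_mono htest
  have hfin := fun s => errorProb_ne_top m k δ v π t s j
  rw [← ENNReal.toReal_add (hfin s) (hfin s')]
  exact (ENNReal.ofReal_le_iff_le_toReal
    (ENNReal.add_ne_top.2 ⟨hfin s, hfin s'⟩)).1 hsum

/-- Flipping the better arm on one piece is an involution of the hard instances. -/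
lemma update_add_one_involutive {m : ℕ} (j : Fin m) :
    Function.Involutive fun s : Fin m → Fin 2 => Function.update s j (s j + 1) := by
  intro s
  have h : ∀ a : Fin 2, a + 1 + 1 = a := by decide
  simp [h]

/-- Averaging over the hard instances: some instance has regret of order `T δ`. -/
lemma exists_le_regret_hardModel {m k T : ℕ} {δ : ℝ} {v : ℝ≥0} (hv : v ≠ 0) (hm : 0 < m)
    (hmk : m ≤ k) (hmT : m ≤ T) (hδ : 0 ≤ δ) (hδm : δ ≤ 1 / (4 * m))
    (hδv : δ ^ 2 / v ≤ m / T) (π : Policy) :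
    ∃ s : Fin m → Fin 2, (Real.exp 2)⁻¹ / 4 * (T * δ) ≤ regret T π (hardModel m k δ v s) := by
  have hm' : (0 : ℝ) < m := by exact_mod_cast hm
  have hpair : ∀ t ∈ Finset.range T, ∀ j : Fin m,
      ∑ _s : Fin m → Fin 2, (Real.exp 2)⁻¹ / (4 * m) ≤
        ∑ s : Fin m → Fin 2, (errorProb m k δ v π t s j).toReal := by
    intro t ht j
    have hflip : ∑ s : Fin m → Fin 2,
        (errorProb m k δ v π t (Function.update s j (s j + 1)) j).toReal =
        ∑ s : Fin m → Fin 2, (errorProb m k δ v π t s j).toReal :=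
      Equiv.sum_comp (update_add_one_involutive j).toPerm
        fun s => (errorProb m k δ v π t s j).toReal
    have hadd := Finset.sum_le_sum fun s (_ : s ∈ (Finset.univ : Finset (Fin m → Fin 2))) =>
      le_errorProb_add hv hmk hmT hδ hδv π (Finset.mem_range.1 ht).le s j
    rw [Finset.sum_add_distrib, hflip, ← two_mul] at hadd
    have hhalf : (Real.exp 2)⁻¹ / (2 * m) = 2 * ((Real.exp 2)⁻¹ / (4 * m)) := by
      field_simp
      norm_num
    simp_rw [hhalf, ← Finset.mul_sum] at hadd
    linarith
  have htotal : ∑ _s : Fin m → Fin 2, (Real.exp 2)⁻¹ / 4 * (T * δ) ≤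
      ∑ s : Fin m → Fin 2, regret T π (hardModel m k δ v s) := by
    calc ∑ _s : Fin m → Fin 2, (Real.exp 2)⁻¹ / 4 * (T * δ)
        = ∑ _t ∈ Finset.range T, ∑ _j : Fin m, δ * ∑ _s : Fin m → Fin 2,
            (Real.exp 2)⁻¹ / (4 * m) := by
          simp only [Finset.sum_const, nsmul_eq_mul, Finset.card_range, Finset.card_univ,
            Fintype.card_fin]
          field_simp
      _ ≤ ∑ t ∈ Finset.range T, ∑ j : Fin m, δ * ∑ s : Fin m → Fin 2,
            (errorProb m k δ v π t s j).toReal :=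
          Finset.sum_le_sum fun t ht => Finset.sum_le_sum fun j _ =>
            mul_le_mul_of_nonneg_left (hpair t ht j) hδ
      _ = _ := by
          simp_rw [regret_hardModel v (hm.trans_le hmk) hδ hδm π T, Finset.mul_sum]
          symm
          rw [Finset.sum_comm]
          refine Finset.sum_congr rfl fun t _ => ?_
          rw [Finset.sum_comm]
  obtain ⟨s, -, hs⟩ := Finset.exists_le_of_sum_le Finset.univ_nonempty htotal
  exact ⟨s, hs⟩

/-! ### The minimax lower bounds -/

/-- The number of pieces on which the arms are made to differ: at most `k`, and of order at
most `T ^ (1/3)`. -/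
lemma exists_number_of_pieces {T k : ℕ} (hT : 1 ≤ T) (hk : 1 ≤ k) :
    ∃ m : ℕ, 0 < m ∧ m ≤ k ∧ m ^ 3 ≤ T ∧ (m = k ∨ T ≤ (2 * m) ^ 3) := by
  classical
  set P : ℕ → Prop := fun m => m ^ 3 ≤ T
  have h1 : P 1 := by simpa [P] using hT
  have hm1 : 1 ≤ Nat.findGreatest P k := Nat.le_findGreatest hk h1
  refine ⟨Nat.findGreatest P k, hm1, Nat.findGreatest_le k, Nat.findGreatest_spec hk h1, ?_⟩
  rcases (Nat.findGreatest_le (P := P) k).eq_or_lt with h | h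
  · exact Or.inl h
  · right
    have h2 : ¬ P (Nat.findGreatest P k + 1) :=
      Nat.findGreatest_is_greatest (Nat.lt_succ_self _) h
    exact (not_le.1 h2).le.trans (Nat.pow_le_pow_left (by omega) 3)

lemma half_min_le_sqrt {T k m : ℕ} (hm : 0 < m) (h : m = k ∨ T ≤ (2 * m) ^ 3) :
    1 / 2 * min (Real.sqrt (k * T)) ((T : ℝ) ^ (2 / 3 : ℝ)) ≤ Real.sqrt (m * T) := by
  rcases h with rfl | h
  · refine (mul_le_mul_of_nonneg_left (min_le_left _ _) (by norm_num)).trans ?_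
    linarith [Real.sqrt_nonneg ((m : ℝ) * T)]
  · refine (mul_le_mul_of_nonneg_left (min_le_right _ _) (by norm_num)).trans ?_
    have hT : (0 : ℝ) ≤ T := Nat.cast_nonneg T
    -- With `r = T ^ (1/3)`, the claim is `r ^ 4 / 4 ≤ m r ^ 3`, and `r ≤ 2 m`.
    set r : ℝ := (T : ℝ) ^ (1 / 3 : ℝ) with hr
    have hr0 : 0 ≤ r := by positivity
    have hr3 : r ^ 3 = T := by
      rw [hr, ← Real.rpow_natCast, ← Real.rpow_mul hT]
      norm_num
    have hr2 : (T : ℝ) ^ (2 / 3 : ℝ) = r ^ 2 := by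
      rw [hr, ← Real.rpow_natCast, ← Real.rpow_mul hT]
      norm_num
    have hrm : r ≤ 2 * m := by
      refine le_of_pow_le_pow_left₀ three_ne_zero (by positivity) ?_
      rw [hr3]
      exact_mod_cast h
    rw [hr2, ← hr3]
    refine Real.le_sqrt_of_sq_le ?_
    have : r * r ^ 3 ≤ 2 * m * r ^ 3 := by gcongr
    have : 0 ≤ m * r ^ 3 := by positivity
    nlinarith

lemma minimaxRegret_mono {T : ℕ} {𝒟 𝒟' : Set Model} (h : 𝒟 ⊆ 𝒟') :
    minimaxRegret T 𝒟 ≤ minimaxRegret T 𝒟' :=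
  iInf_mono fun _ => biSup_mono h

lemma isotonicPiecesClass_subset (k : ℕ) (C L : ℝ) :
    isotonicPiecesClass k C L ⊆ isotonicClass C L := fun _ hD => ⟨fun a => (hD.1 a).1, hD.2⟩

lemma le_minimaxRegret_pieces {C L : ℝ} {v : ℝ≥0} (hv : v ≠ 0)
    (hnoise : IsNoise C L (gaussianReal 0 v)) {T k : ℕ} (hT : 1 ≤ T) (hk : 1 ≤ k) :
    (((Real.exp 2)⁻¹ / 8 * min (1 / 4) (Real.sqrt v) *
      min (Real.sqrt (k * T)) ((T : ℝ) ^ (2 / 3 : ℝ)) : ℝ) : EReal) ≤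
        minimaxRegret T (isotonicPiecesClass k C L) := by
  obtain ⟨m, hm, hmk, hmT3, hor⟩ := exists_number_of_pieces hT hk
  have hmT : m ≤ T := (Nat.le_self_pow three_ne_zero m).trans hmT3
  have hm' : (0 : ℝ) < m := by exact_mod_cast hm
  have hT' : (0 : ℝ) < T := by exact_mod_cast hT
  have hv' : (0 : ℝ) < v := by positivity
  set c := min (1 / 4) (Real.sqrt v) with hc
  have hc0 : 0 ≤ c := by positivity
  -- The gap is as large as `T / m` observations per piece leave undetected.
  set δ := c * Real.sqrt (m / T) with hδdef
  have hδ : 0 ≤ δ := by positivity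
  have hδm : δ ≤ 1 / (4 * m) := by
    have h1 : Real.sqrt (m / T) ≤ 1 / m := by
      refine Real.sqrt_le_iff.2 ⟨by positivity, ?_⟩
      have : (m : ℝ) ^ 3 ≤ T := by exact_mod_cast hmT3
      rw [div_pow, one_pow, div_le_div_iff₀ hT' (by positivity)]
      linarith
    calc δ ≤ 1 / 4 * (1 / m) := mul_le_mul (min_le_left _ _) h1 (by positivity) (by norm_num)
      _ = 1 / (4 * m) := by ring
  have hδv : δ ^ 2 / v ≤ m / T := by
    rw [hδdef, mul_pow, Real.sq_sqrt (by positivity), div_le_iff₀ hv', mul_comm]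
    refine mul_le_mul_of_nonneg_left ?_ (by positivity)
    calc c ^ 2 ≤ Real.sqrt v ^ 2 := pow_le_pow_left₀ hc0 (min_le_right _ _) 2
      _ = v := Real.sq_sqrt hv'.le
  have hTδ : T * δ = c * Real.sqrt (m * T) := by
    have : Real.sqrt (m * T) = T * Real.sqrt (m / T) := by
      rw [show (m : ℝ) * T = T ^ 2 * (m / T) by field_simp, Real.sqrt_mul (by positivity),
        Real.sqrt_sq hT'.le]
    rw [this, hδdef]
    ring
  refine le_iInf fun π => ?_
  obtain ⟨s, hs⟩ := exists_le_regret_hardModel hv hm hmk hmT hδ hδm hδv π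
  have hmem : hardModel m k δ v s ∈ isotonicPiecesClass k C L :=
    ⟨hardModel_mem_isotonicPieces hm hk hδ hδm s, hnoise⟩
  refine le_trans ?_ (le_iSup₂ (f := fun D (_ : D ∈ isotonicPiecesClass k C L) =>
    (regret T π D : EReal)) _ hmem)
  refine EReal.coe_le_coe_iff.2 (le_trans ?_ hs)
  rw [hTδ]
  calc _ = (Real.exp 2)⁻¹ / 4 * (c * (1 / 2 *
        min (Real.sqrt (k * T)) ((T : ℝ) ^ (2 / 3 : ℝ)))) := by ring
    _ ≤ _ := by
      gcongr
      exact half_min_le_sqrt hm hor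

end IsotonicBandit

end

theorem mainTheorem2 (C L : ℝ) (hC : 0 < C) (hL : 0 < L) (hCL : C * L < 1 / 2) :
    ∃ c : ℝ, 0 < c ∧ ∀ T : ℕ, 1 ≤ T →
      ((c * (T : ℝ) ^ (2 / 3 : ℝ) : ℝ) : EReal) ≤
        IsotonicBandit.minimaxRegret T (IsotonicBandit.isotonicClass C L) ∧
      ∀ k : ℕ, 1 ≤ k →
        ((c * min (Real.sqrt (k * T)) ((T : ℝ) ^ (2 / 3 : ℝ)) : ℝ) : EReal) ≤
          IsotonicBandit.minimaxRegret T (IsotonicBandit.isotonicPiecesClass k C L) := by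
  obtain ⟨v, hv, hnoise⟩ := IsotonicBandit.exists_isNoise_gaussianReal hL hCL
  refine ⟨(Real.exp 2)⁻¹ / 8 * min (1 / 4) (Real.sqrt v), ?_, fun T hT => ⟨?_, fun k hk =>
    IsotonicBandit.le_minimaxRegret_pieces hv hnoise hT hk⟩⟩
  · have : (0 : ℝ) < v := by positivity
    positivity
  · -- For `k = T` the minimum is `T ^ (2/3)`.
    have h := (IsotonicBandit.le_minimaxRegret_pieces hv hnoise hT hT).trans
      (IsotonicBandit.minimaxRegret_mono (IsotonicBandit.isotonicPiecesClass_subset T C L))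
    have hT' : (1 : ℝ) ≤ T := by exact_mod_cast hT
    have hmin : min (Real.sqrt (T * T)) ((T : ℝ) ^ (2 / 3 : ℝ)) = (T : ℝ) ^ (2 / 3 : ℝ) := by
      rw [Real.sqrt_mul_self (by linarith)]
      refine min_eq_right ?_
      calc (T : ℝ) ^ (2 / 3 : ℝ) ≤ (T : ℝ) ^ (1 : ℝ) :=
            Real.rpow_le_rpow_of_exponent_le hT' (by norm_num)
        _ = T := Real.rpow_one _
    rwa [hmin] at h
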